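/- Let $n\ge 1$ and let $\|\cdot\|$ denote the Euclidean norm on $\mathbb R^n$ and the spectral norm on $\mathbb R^{n\times n}$. For a matrix $A\in\Lambda=\{A\in\mathbb R^{n\times n}:\|A\|\le 1\}$ consider the system $$Y_{t+1}=AY_t+U_t+V_{t+1},\qquad t=1,2,\dots,$$ where $\{V_t\}$ is an i.i.d. sequence of $N(0,\sigma^2 I_{n\times n})$ random vectors independent of the initial state $Y_1$, $\mathbb E\|Y_1\|^2<\infty$, and $Y_1$ is not almost surely equal to $0$. A controller $\gamma=\{\gamma_t\}_{t\ge1}$ is a sequence of deterministic Borel maps $\gamma_t:(\mathbb R^n)^t\times(\mathbb R^n)^{t-1}\to\mathbb R^n$, and the inputs are $U_t=\gamma_t(Y_1,\dots,Y_t,U_1,\dots,U_{t-1})$; let $\Pi_{A,\gamma}$ and $\mathbb E_{A,\gamma}$ denote the resulting law and expectation. Define $$R_T(\gamma,A)=\mathbb E_{A,\gamma}\Big\{\sum_{t=1}^T\|Y_{t+1}-V_{t+1}\|^2\Big\}\in[0,\infty],\qquad T^*_\gamma(\varepsilon)=\sup_{A\in\Lambda}\inf\Big\{T\ge1:\frac{R_T(\gamma,A)}{T}<\varepsilon\Big\}\quad(\inf\varnothing=\infty).$$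 For $c>0$ and $\delta\in(0,1)$, the controller $\gamma$ has the $(c,\delta)$-persistent excitation property if there is $T_0\in\mathbb N$ such that, for every $A\in\Lambda$ and every $T\ge T_0$, $$\Pi_{A,\gamma}\Big(\frac1T\sum_{t=1}^T Y_tY_t^{\mathsf T}-c\,I_{n\times n}\text{ is positive semidefinite}\Big)\ge 1-\delta .$$ Theorem. For every $c>0$ and $\delta\in(0,1/4)$ there is a constant $\kappa>0$, depending only on $c$ and $\delta$, such that for all $n$, all $\sigma$, all laws of $Y_1$ as above, and every controller $\gamma$ with the $(c,\delta)$-persistent excitation property, $$T^*_\gamma(\varepsilon)\ \ge\ \kappa\,\frac{n^2\sigma^2}{\varepsilon}\log\frac1\varepsilon\qquad\text{for all sufficiently small }\varepsilon>0,$$ that is, $T^*_\gamma(\varepsilon)=\Omega\big(\frac{n^2\sigma^2}{\varepsilon}\log\frac1\varepsilon\big)$ as $\varepsilon\to0$. (How small $\varepsilon$ must be may depend on $n$, $\sigma$, the law of $Y_1$ and $\gamma$.) -/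

import Mathlib

open MeasureTheory ProbabilityTheory Filter Topology
open scoped ENNReal NNReal

noncomputable section

namespace AdaptiveControl

/-- The state, input and output space `ℝⁿ` with its Euclidean norm. -/
abbrev Vec (n : ℕ) : Type := EuclideanSpace ℝ (Fin n)

/-! Time is counted from `0`: index `t` stands for the `(t + 1)`-st time step, for outputs, inputs
and disturbances alike. -/

/-- An admissible controller: a sequence of deterministic Borel maps, the input at step `t` being a
function of the outputs at steps `0, …, t` and the inputs at steps `0, …, t - 1`. -/
structure Controller (n : ℕ) where
  /-- the control law at step `t` -/
  act : (t : ℕ) → (Fin (t + 1) → Vec n) × (Fin t → Vec n) → Vec n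
  measurable_act : ∀ t, Measurable (act t)

/-- The uncertainty set: real `n × n` matrices of spectral norm at most one. -/
def uncertaintySet (n : ℕ) : Set (Matrix (Fin n) (Fin n) ℝ) :=
  {A | ‖Matrix.toEuclideanCLM (n := Fin n) (𝕜 := ℝ) A‖ ≤ 1}

section ClosedLoop

variable {n : ℕ} (A : Matrix (Fin n) (Fin n) ℝ) (γ : Controller n) (y₁ : Vec n) (v : ℕ → Vec n)

/-- The outputs at steps `0, …, t` and the inputs at steps `0, …, t - 1` of the system `A` in
closed loop with `γ`, for the initial state `y₁` and the realization `v` of the disturbances. -/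
def history : (t : ℕ) → (Fin (t + 1) → Vec n) × (Fin t → Vec n)
  | 0 => (fun _ => y₁, Fin.elim0)
  | t + 1 =>
    (Fin.snoc (α := fun _ => Vec n) (history t).1
      (Matrix.toEuclideanCLM (n := Fin n) (𝕜 := ℝ) A ((history t).1 (Fin.last t))
        + γ.act t (history t) + v (t + 1)),
     Fin.snoc (α := fun _ => Vec n) (history t).2 (γ.act t (history t)))

/-- The output at step `t`. -/
def output (t : ℕ) : Vec n := (history A γ y₁ v t).1 (Fin.last t)

/-- The input at step `t`. -/
def input (t : ℕ) : Vec n := γ.act t (history A γ y₁ v t)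

theorem output_zero : output A γ y₁ v 0 = y₁ := rfl

/-- The system equation. -/
theorem output_succ (t : ℕ) :
    output A γ y₁ v (t + 1) =
      Matrix.toEuclideanCLM (n := Fin n) (𝕜 := ℝ) A (output A γ y₁ v t)
        + input A γ y₁ v t + v (t + 1) := by
  simp [output, input, history]

theorem history_eq (t : ℕ) :
    history A γ y₁ v t =
      (fun i : Fin (t + 1) => output A γ y₁ v i, fun i : Fin t => input A γ y₁ v i) := by
  induction t with
  | zero =>
    refine Prod.ext (funext fun i => ?_) (funext fun i => i.elim0)
    obtain rfl : i = Fin.last 0 := Fin.ext (by omega)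
    rfl
  | succ t ih =>
    refine Prod.ext (funext fun i => ?_) (funext fun i => ?_)
    · refine Fin.lastCases ?_ (fun j => ?_) i
      · rfl
      · simpa [history] using congrFun (congrArg Prod.fst ih) j
    · refine Fin.lastCases ?_ (fun j => ?_) i
      · simp [history, input]
      · simpa [history] using congrFun (congrArg Prod.snd ih) j

/-- The control law. -/
theorem input_eq (t : ℕ) :
    input A γ y₁ v t =
      γ.act t
        (fun i : Fin (t + 1) => output A γ y₁ v i, fun i : Fin t => input A γ y₁ v i) := by
  rw [← history_eq]; rfl

end ClosedLoop

section Performance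

variable {n : ℕ} {Ω : Type*} [MeasurableSpace Ω] (P : Measure Ω)
  (Y₁ : Ω → Vec n) (V : ℕ → Ω → Vec n)

/-- The `T`-step regret `𝔼 ∑_{t=1}^T ‖Y_{t+1} - V_{t+1}‖²` of `γ` on `A`, possibly infinite. -/
def regret (γ : Controller n) (A : Matrix (Fin n) (Fin n) ℝ) (T : ℕ) : ℝ≥0∞ :=
  ∫⁻ ω, ∑ t ∈ Finset.range T,
    ‖output A γ (Y₁ ω) (fun s => V s ω) (t + 1) - V (t + 1) ω‖ₑ ^ 2 ∂P

/-- The minimum time to achieve average regret below `ε` on every `A` in the uncertainty set: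
`sup_A inf {T ≥ 1 : R_T(γ, A) / T < ε}`, with `inf ∅ = ∞`. -/
def minTime (γ : Controller n) (ε : ℝ) : ℕ∞ :=
  ⨆ A ∈ uncertaintySet n,
    ⨅ T ∈ {T : ℕ | 1 ≤ T ∧ regret P Y₁ V γ A T / (T : ℝ≥0∞) < ENNReal.ofReal ε}, (T : ℕ∞)

/-- The empirical second-moment matrix `(1/T) ∑_{t=1}^T Y_t Y_tᵀ`. -/
def empiricalMoment (A : Matrix (Fin n) (Fin n) ℝ) (γ : Controller n) (y₁ : Vec n)
    (v : ℕ → Vec n) (T : ℕ) : Matrix (Fin n) (Fin n) ℝ :=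
  (T : ℝ)⁻¹ • ∑ t ∈ Finset.range T,
    Matrix.vecMulVec (fun i => output A γ y₁ v t i) (fun i => output A γ y₁ v t i)

/-- The `(c, δ)`-persistent excitation property. -/
def PersistentExcitation (γ : Controller n) (c δ : ℝ) : Prop :=
  ∃ T₀ : ℕ, ∀ A ∈ uncertaintySet n, ∀ T ≥ T₀,
    ENNReal.ofReal (1 - δ) ≤
      P {ω | (empiricalMoment A γ (Y₁ ω) (fun s => V s ω) T
        - c • (1 : Matrix (Fin n) (Fin n) ℝ)).PosSemidef}

end Performance

end AdaptiveControl

end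

namespace AdaptiveControl
open scoped RealInnerProductSpace

/-! Low regret together with excitation identifies `A`, and identification among many candidates
costs likelihood that only accumulated regret can pay for.

Suppose every `A` reaches average regret below `ε` before time `τ`. Take a grid of about `(b
ε^(-1/2))^(n²)` admissible matrices, with mesh of order `√(ε/c)`. If `A Y_t + U_t` and `B Y_t + U_t`
both have mean square of order `ε`, so does `(A - B) Y_t`; excitation forbids this for distinct grid
points. Hence the good histories of distinct grid points at a common time are disjoint
(`disjoint_goodHistories`), while each has probability at least `1/4` in its own closed loop
(`quarter_le_measure_goodHistories`).

Next compare with the system whose outputs after the initial one are pure noise, which does not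
depend on `A`. A second-moment Girsanov bound (`measure_history_sq_le`) gives each good event
probability at least `exp(-4ετ/σ²)/16` there. Disjoint events have total probability at most one.
Learning times may differ between grid points, but rounding them down to powers of two leaves only
`O(log τ)` classes. So the grid has at most `O(log τ) exp(4ετ/σ²)` points
(`card_le_of_fast_learning`), which fails for `τ` a small multiple of `n²σ² ε⁻¹ log(1/ε)`.

Excitation is available only from time `T₀` on. As `Y₁` is not almost surely zero, the grid can be
placed where the first-step regret is bounded below (`exists_center_regret_one_ge`); this rules out
early learning once `ε` is small. -/

/-! ### Isotropic Gaussian law: density and translation -/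

theorem charFun_isotropicGaussian {n : ℕ} (σ : ℝ≥0) (t : Vec n) :
    charFun (multivariateGaussian 0 ((σ : ℝ) ^ 2 • (1 : Matrix (Fin n) (Fin n) ℝ))) t =
      Complex.exp (-((σ : ℂ) ^ 2 * ‖t‖ ^ 2 / 2)) := by
  rw [charFun_multivariateGaussian (Matrix.PosSemidef.one.smul (by positivity))]
  congr 1
  have : (t.ofLp ⬝ᵥ ((σ : ℝ) ^ 2 • (1 : Matrix (Fin n) (Fin n) ℝ)).mulVec t.ofLp) =
      (σ : ℝ) ^ 2 * ‖t‖ ^ 2 := by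
    rw [Matrix.smul_mulVec, Matrix.one_mulVec, dotProduct_smul, EuclideanSpace.real_norm_sq_eq]
    simp [dotProduct, sq]
  rw [this]
  simp

/-- The Lebesgue density of the isotropic Gaussian law. -/
noncomputable def isotropicDensity (n : ℕ) (σ : ℝ≥0) (v : Vec n) : ℝ :=
  (Real.pi / (1 / (2 * (σ : ℝ) ^ 2))) ^ (-((n : ℝ) / 2)) *
    Real.exp (-(1 / (2 * (σ : ℝ) ^ 2)) * ‖v‖ ^ 2)

theorem isotropicDensity_nonneg {n : ℕ} (σ : ℝ≥0) (v : Vec n) : 0 ≤ isotropicDensity n σ v := by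
  unfold isotropicDensity; positivity

theorem measurable_isotropicDensity (n : ℕ) (σ : ℝ≥0) : Measurable (isotropicDensity n σ) := by
  unfold isotropicDensity; fun_prop

theorem integrable_isotropicDensity (n : ℕ) {σ : ℝ≥0} (hσ : σ ≠ 0) :
    Integrable (isotropicDensity n σ) := by
  have hs : (0 : ℝ) < σ := by exact_mod_cast pos_iff_ne_zero.2 hσ
  refine Integrable.const_mul ?_ _
  have := (GaussianFourier.integrable_cexp_neg_mul_sq_norm_add (V := Vec n)
    (b := ((1 / (2 * (σ : ℝ) ^ 2) : ℝ) : ℂ)) (by rw [Complex.ofReal_re]; positivity) 0 0).re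
  refine this.congr (.of_forall fun v => ?_)
  have h : (-((1 / (2 * (σ : ℝ) ^ 2) : ℝ) : ℂ) * (‖v‖ : ℂ) ^ 2 + 0 * ((⟪(0 : Vec n), v⟫ : ℝ) : ℂ))
    = ((-(1 / (2 * (σ : ℝ) ^ 2)) * ‖v‖ ^ 2 : ℝ) : ℂ) := by push_cast; ring
  simp only [h]
  rw [← Complex.ofReal_exp]
  exact Complex.ofReal_re _

/-- Both measures are finite and have the same characteristic function, by the Gaussian Fourier
integral. -/
theorem isotropicGaussian_eq_withDensity (n : ℕ) {σ : ℝ≥0} (hσ : σ ≠ 0) :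
    multivariateGaussian 0 ((σ : ℝ) ^ 2 • (1 : Matrix (Fin n) (Fin n) ℝ)) =
      (volume : Measure (Vec n)).withDensity fun v => ENNReal.ofReal (isotropicDensity n σ v) := by
  have hs : (0 : ℝ) < σ := by exact_mod_cast pos_iff_ne_zero.2 hσ
  have : IsFiniteMeasure ((volume : Measure (Vec n)).withDensity
      fun v => ENNReal.ofReal (isotropicDensity n σ v)) :=
    isFiniteMeasure_withDensity_ofReal (integrable_isotropicDensity n hσ).2
  refine Measure.ext_of_charFun (funext fun t => ?_)
  rw [charFun_isotropicGaussian, charFun_apply,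
    integral_withDensity_eq_integral_toReal_smul (by
      exact (measurable_isotropicDensity n σ).ennreal_ofReal) (.of_forall fun _ => by simp)]
  simp_rw [ENNReal.toReal_ofReal (isotropicDensity_nonneg σ _)]
  set b : ℝ := 1 / (2 * (σ : ℝ) ^ 2) with hb
  have hb0 : 0 < b := by positivity
  have key := GaussianFourier.integral_cexp_neg_mul_sq_norm_add (V := Vec n)
    (b := (b : ℂ)) (by rwa [Complex.ofReal_re]) Complex.I t
  have hint : ∀ v : Vec n, isotropicDensity n σ v • Complex.exp ((⟪v, t⟫ : ℝ) * Complex.I) =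
      (((Real.pi / b) ^ (-((n : ℝ) / 2)) : ℝ) : ℂ) *
        Complex.exp (-(b : ℂ) * ‖v‖ ^ 2 + Complex.I * (⟪t, v⟫ : ℝ)) := by
    intro v
    rw [isotropicDensity, ← hb, Complex.exp_add, Complex.real_smul, real_inner_comm]
    push_cast
    rw [mul_comm Complex.I]
    ring
  simp_rw [hint]
  rw [integral_const_mul, key, ← mul_assoc]
  have h1 : (((Real.pi / b) ^ (-((n : ℝ) / 2)) : ℝ) : ℂ) *
      ((Real.pi : ℂ) / b) ^ ((Module.finrank ℝ (Vec n) : ℂ) / 2) = 1 := by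
    have : ((Real.pi : ℂ) / b) ^ ((Module.finrank ℝ (Vec n) : ℂ) / 2) =
        (((Real.pi / b) ^ ((n : ℝ) / 2) : ℝ) : ℂ) := by
      rw [Complex.ofReal_cpow (by positivity)]
      simp
    rw [this, ← Complex.ofReal_mul, ← Real.rpow_add (by positivity)]
    simp
  rw [h1, one_mul]
  congr 1
  rw [hb, Complex.I_sq]
  push_cast
  have : (σ : ℂ) ≠ 0 := by exact_mod_cast hσ
  field_simp
  norm_num

/-- The Cameron–Martin formula for the isotropic Gaussian law. -/
theorem lintegral_add_isotropicGaussian {n : ℕ} {σ : ℝ≥0} (hσ : σ ≠ 0) (m : Vec n)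
    {g : Vec n → ℝ≥0∞} (hg : Measurable g) :
    ∫⁻ v, g (m + v) ∂(multivariateGaussian 0 ((σ : ℝ) ^ 2 • (1 : Matrix (Fin n) (Fin n) ℝ))) =
      ∫⁻ v, g v * ENNReal.ofReal (Real.exp ((⟪m, v⟫ - ‖m‖ ^ 2 / 2) / (σ : ℝ) ^ 2))
        ∂(multivariateGaussian 0 ((σ : ℝ) ^ 2 • (1 : Matrix (Fin n) (Fin n) ℝ))) := by
  have hs : (0 : ℝ) < σ := by exact_mod_cast pos_iff_ne_zero.2 hσ
  have hd := (measurable_isotropicDensity n σ).ennreal_ofReal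
  rw [isotropicGaussian_eq_withDensity n hσ, lintegral_withDensity_eq_lintegral_mul _ hd
    (by fun_prop), lintegral_withDensity_eq_lintegral_mul _ hd (by fun_prop),
    ← lintegral_add_left_eq_self _ (-m)]
  refine lintegral_congr fun v => ?_
  simp only [Pi.mul_apply, add_neg_cancel_left]
  rw [mul_left_comm, ← ENNReal.ofReal_mul (isotropicDensity_nonneg σ v), mul_comm]
  congr 2
  rw [isotropicDensity, isotropicDensity, mul_assoc, ← Real.exp_add]
  congr 2
  rw [neg_add_eq_sub, norm_sub_sq_real, real_inner_comm]
  field_simp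
  ring

/-! ### Closed loop with scaled drift, and its log-likelihood -/

section Driven

/-- The outputs up to step `t` and the inputs up to step `t - 1`. -/
abbrev Hist (n t : ℕ) : Type := (Fin (t + 1) → Vec n) × (Fin t → Vec n)

variable {n : ℕ}

/-- The history obtained from `h` by observing the output `y`. -/
def Controller.extend (γ : Controller n) {t : ℕ} (h : Hist n t) (y : Vec n) : Hist n (t + 1) :=
  (Fin.snoc (α := fun _ => Vec n) h.1 y, Fin.snoc (α := fun _ => Vec n) h.2 (γ.act t h))

theorem Controller.measurable_extend (γ : Controller n) (t : ℕ) :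
    Measurable fun p : Hist n t × Vec n => γ.extend p.1 p.2 := by
  have hγ := γ.measurable_act t
  refine Measurable.prodMk (measurable_pi_lambda _ fun i => ?_) (measurable_pi_lambda _ fun i => ?_)
  · refine Fin.lastCases ?_ (fun j => ?_) i
    · simpa using measurable_snd
    · simpa using! (measurable_pi_apply j).comp (measurable_fst.comp measurable_fst)
  · refine Fin.lastCases ?_ (fun j => ?_) i
    · simpa using! hγ.comp measurable_fst
    · simpa using! (measurable_pi_apply j).comp (measurable_snd.comp measurable_fst)

/-- The noiseless next output `A Y_t + U_t`. -/
noncomputable def nextMean (A : Matrix (Fin n) (Fin n) ℝ) (γ : Controller n) {t : ℕ}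
    (h : Hist n t) : Vec n :=
  Matrix.toEuclideanCLM (n := Fin n) (𝕜 := ℝ) A (h.1 (Fin.last t)) + γ.act t h

theorem measurable_nextMean (A : Matrix (Fin n) (Fin n) ℝ) (γ : Controller n) (t : ℕ) :
    Measurable (nextMean A γ (t := t)) := by
  have hγ := γ.measurable_act t
  unfold nextMean
  fun_prop

/-- The history of the system in which the noiseless next output is multiplied by `a`: the closed
loop for `a = 1`, pure noise for `a = 0`. -/
noncomputable def scaledHistory (a : ℝ) (A : Matrix (Fin n) (Fin n) ℝ) (γ : Controller n)
    (y₁ : Vec n) (v : ℕ → Vec n) : (t : ℕ) → Hist n t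
  | 0 => (fun _ => y₁, Fin.elim0)
  | t + 1 => γ.extend (scaledHistory a A γ y₁ v t)
      (a • nextMean A γ (scaledHistory a A γ y₁ v t) + v (t + 1))

variable (a : ℝ) (A : Matrix (Fin n) (Fin n) ℝ) (γ : Controller n)

theorem scaledHistory_one (y₁ : Vec n) (v : ℕ → Vec n) (t : ℕ) :
    scaledHistory 1 A γ y₁ v t = history A γ y₁ v t := by
  induction t with
  | zero => rfl
  | succ t ih => simp [scaledHistory, history, Controller.extend, nextMean, ih]

/-- This makes pure noise a common reference for all candidate matrices. -/
theorem scaledHistory_zero_eq (B : Matrix (Fin n) (Fin n) ℝ) (y₁ : Vec n) (v : ℕ → Vec n)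
    (t : ℕ) : scaledHistory 0 A γ y₁ v t = scaledHistory 0 B γ y₁ v t := by
  induction t with
  | zero => rfl
  | succ t ih => simp [scaledHistory, ih]

theorem measurable_scaledHistory (t : ℕ) :
    Measurable fun p : Vec n × (ℕ → Vec n) => scaledHistory a A γ p.1 p.2 t := by
  induction t with
  | zero =>
    exact Measurable.prodMk (measurable_pi_lambda _ fun _ => measurable_fst)
      (measurable_pi_lambda _ fun i => i.elim0)
  | succ t ih =>
    have h1 := (measurable_nextMean A γ t).comp ih
    have h2 : Measurable fun p : Vec n × (ℕ → Vec n) =>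
        a • nextMean A γ (scaledHistory a A γ p.1 p.2 t) + p.2 (t + 1) := by
      refine (h1.const_smul a).add ?_
      fun_prop
    exact (γ.measurable_extend t).comp (ih.prodMk h2)

theorem scaledHistory_congr (y₁ : Vec n) {v w : ℕ → Vec n} (t : ℕ) (h : ∀ s ≤ t, v s = w s) :
    scaledHistory a A γ y₁ v t = scaledHistory a A γ y₁ w t := by
  induction t with
  | zero => rfl
  | succ t ih => simp only [scaledHistory, ih fun s hs => h s (by omega), h (t + 1) le_rfl]

/-- The noiseless next output at step `s`, read off a later history. -/
noncomputable def meanAt {t : ℕ} (h : Hist n t) (s : Fin t) : Vec n :=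
  Matrix.toEuclideanCLM (n := Fin n) (𝕜 := ℝ) A (h.1 s.castSucc) + h.2 s

/-- The accumulated squared norm of the noiseless next outputs. -/
noncomputable def energy {t : ℕ} (h : Hist n t) : ℝ := ∑ s, ‖meanAt A h s‖ ^ 2

/-- The log-likelihood ratio of the scaled system with respect to pure noise. -/
noncomputable def logLikelihood (σ : ℝ≥0) {t : ℕ} (h : Hist n t) : ℝ :=
  ∑ s, (⟪a • meanAt A h s, h.1 s.succ⟫ - ‖a • meanAt A h s‖ ^ 2 / 2) / (σ : ℝ) ^ 2

theorem measurable_meanAt {t : ℕ} (s : Fin t) : Measurable fun h : Hist n t => meanAt A h s := by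
  unfold meanAt
  fun_prop

theorem measurable_energy (t : ℕ) : Measurable (energy A (t := t)) := by
  have := fun s : Fin t => measurable_meanAt A s
  unfold energy
  fun_prop

theorem measurable_logLikelihood (σ : ℝ≥0) (t : ℕ) :
    Measurable (logLikelihood a A σ (t := t)) := by
  have := fun s : Fin t => measurable_meanAt A s
  unfold logLikelihood
  fun_prop

theorem logLikelihood_extend (σ : ℝ≥0) {t : ℕ} (h : Hist n t) (y : Vec n) :
    logLikelihood a A σ (γ.extend h y) = logLikelihood a A σ h +
      (⟪a • nextMean A γ h, y⟫ - ‖a • nextMean A γ h‖ ^ 2 / 2) / (σ : ℝ) ^ 2 := by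
  rw [logLikelihood, Fin.sum_univ_castSucc]
  simp only [logLikelihood, meanAt, Controller.extend, nextMean, ← Fin.castSucc_succ,
    Fin.snoc_castSucc, Fin.succ_last, Fin.snoc_last]

end Driven

/-! ### Change of measure between the closed loop and pure noise -/

section Girsanov

variable {n : ℕ} {Ω : Type*} [MeasurableSpace Ω] {P : Measure Ω} [IsProbabilityMeasure P]

theorem lintegral_indepFun {α β : Type*} [MeasurableSpace α] [MeasurableSpace β] {X : Ω → α}
    {Z : Ω → β} (hX : Measurable X) (hZ : Measurable Z) (h : IndepFun X Z P)
    {g : α × β → ℝ≥0∞} (hg : Measurable g) :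
    ∫⁻ ω, g (X ω, Z ω) ∂P = ∫⁻ ω, ∫⁻ z, g (X ω, z) ∂(P.map Z) ∂P := by
  have : IsProbabilityMeasure (P.map Z) := Measure.isProbabilityMeasure_map hZ.aemeasurable
  rw [← lintegral_map (f := g) (g := fun ω => (X ω, Z ω)) hg (hX.prodMk hZ),
    (indepFun_iff_map_prod_eq_prod_map_map hX.aemeasurable hZ.aemeasurable).1 h,
    lintegral_prod _ hg.aemeasurable, lintegral_map hg.lintegral_prod_right' hX]

theorem IndepFun.prodMk_left_of_prodMk_right {α β δ : Type*} [MeasurableSpace α]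
    [MeasurableSpace β] [MeasurableSpace δ] {X : Ω → α} {Y : Ω → β} {Z : Ω → δ}
    (hX : Measurable X) (hY : Measurable Y) (hZ : Measurable Z)
    (h : IndepFun X (fun ω => (Y ω, Z ω)) P) (h' : IndepFun Y Z P) :
    IndepFun (fun ω => (X ω, Y ω)) Z P := by
  have i1 : IsProbabilityMeasure (P.map Z) := Measure.isProbabilityMeasure_map hZ.aemeasurable
  have i2 : IsProbabilityMeasure (P.map Y) := Measure.isProbabilityMeasure_map hY.aemeasurable
  have i3 : IsProbabilityMeasure (P.map X) := Measure.isProbabilityMeasure_map hX.aemeasurable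
  have e1 := (indepFun_iff_map_prod_eq_prod_map_map hX.aemeasurable
    (hY.prodMk hZ).aemeasurable).1 h
  have e2 := (indepFun_iff_map_prod_eq_prod_map_map hY.aemeasurable hZ.aemeasurable).1 h'
  have e3 := (indepFun_iff_map_prod_eq_prod_map_map hX.aemeasurable hY.aemeasurable).1
    (h.comp measurable_id measurable_fst)
  rw [indepFun_iff_map_prod_eq_prod_map_map (hX.prodMk hY).aemeasurable hZ.aemeasurable]
  refine Eq.trans ?_ (e3 ▸ (measurePreserving_prodAssoc (P.map X) (P.map Y) (P.map Z)).symm.map_eq)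
  rw [← e2, ← e1, Measure.map_map (MeasurableEquiv.measurable _) (hX.prodMk (hY.prodMk hZ))]
  rfl

variable {Y₁ : Ω → Vec n} {V : ℕ → Ω → Vec n}

/-- The history at step `t` is a function of `Y₁` and the disturbances with index at most `t`. -/
theorem indepFun_scaledHistory (hY : Measurable Y₁) (hV : ∀ t, Measurable (V t))
    (hVi : iIndepFun V P) (hYV : IndepFun Y₁ (fun ω t => V t ω) P)
    (a : ℝ) (A : Matrix (Fin n) (Fin n) ℝ) (γ : Controller n) (t : ℕ) :
    IndepFun (fun ω => scaledHistory a A γ (Y₁ ω) (fun s => V s ω) t) (V (t + 1)) P := by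
  let W : Ω → (Finset.range (t + 1) → Vec n) := fun ω i => V i ω
  have hW : Measurable W := measurable_pi_lambda _ fun i => hV i
  have hWV : IndepFun W (V (t + 1)) P := by
    have := hVi.indepFun_finset (Finset.range (t + 1)) {t + 1} (by simp) hV
    exact this.comp measurable_id (measurable_pi_apply ⟨t + 1, by simp⟩)
  have hYWV : IndepFun Y₁ (fun ω => (W ω, V (t + 1) ω)) P := by
    refine hYV.comp (φ := id)
      (ψ := fun v : ℕ → Vec n => ((fun i : Finset.range (t + 1) => v i), v (t + 1)))
      measurable_id ?_
    fun_prop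
  have hind := IndepFun.prodMk_left_of_prodMk_right hY hW (hV (t + 1)) hYWV hWV
  -- Padding by zero is harmless: later disturbances do not enter the history at step `t`.
  let ext : (Finset.range (t + 1) → Vec n) → ℕ → Vec n :=
    fun w s => if hs : s ∈ Finset.range (t + 1) then w ⟨s, hs⟩ else 0
  have hext : Measurable ext := by
    refine measurable_pi_lambda _ fun s => ?_
    by_cases hs : s ∈ Finset.range (t + 1)
    · simpa only [ext, hs, dite_true] using measurable_pi_apply _
    · simpa only [ext, hs, dite_false] using measurable_const
  have hφ : Measurable fun p : Vec n × (Finset.range (t + 1) → Vec n) =>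
      scaledHistory a A γ p.1 (ext p.2) t :=
    (measurable_scaledHistory a A γ t).comp
      (measurable_fst.prodMk (hext.comp measurable_snd))
  have := hind.comp hφ measurable_id
  refine this.congr (.of_forall fun ω => ?_) .rfl
  refine scaledHistory_congr a A γ (Y₁ ω) t fun s hs => ?_
  simp [ext, W, hs.not_gt]

/-- The discrete Girsanov formula. -/
theorem lintegral_scaledHistory {σ : ℝ≥0} (hσ : σ ≠ 0) (hY : Measurable Y₁)
    (hV : ∀ t, Measurable (V t))
    (hG : ∀ t, P.map (V t) =
      multivariateGaussian 0 ((σ : ℝ) ^ 2 • (1 : Matrix (Fin n) (Fin n) ℝ)))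
    (hVi : iIndepFun V P) (hYV : IndepFun Y₁ (fun ω t => V t ω) P)
    (a : ℝ) (A : Matrix (Fin n) (Fin n) ℝ) (γ : Controller n) (t : ℕ) {f : Hist n t → ℝ≥0∞}
    (hf : Measurable f) :
    ∫⁻ ω, f (scaledHistory a A γ (Y₁ ω) (fun s => V s ω) t) ∂P =
      ∫⁻ ω, f (scaledHistory 0 A γ (Y₁ ω) (fun s => V s ω) t) *
        ENNReal.ofReal (Real.exp
          (logLikelihood a A σ (scaledHistory 0 A γ (Y₁ ω) (fun s => V s ω) t))) ∂P := by
  have hmeas : ∀ (b : ℝ) (t : ℕ),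
      Measurable fun ω => scaledHistory b A γ (Y₁ ω) (fun s => V s ω) t := fun b t =>
    (measurable_scaledHistory b A γ t).comp (hY.prodMk (measurable_pi_lambda _ hV))
  induction t with
  | zero => simp [scaledHistory, logLikelihood]
  | succ t ih =>
    let G := multivariateGaussian 0 ((σ : ℝ) ^ 2 • (1 : Matrix (Fin n) (Fin n) ℝ))
    let w : Hist n t → Vec n → ℝ≥0∞ := fun h y =>
      ENNReal.ofReal (Real.exp ((⟪a • nextMean A γ h, y⟫ - ‖a • nextMean A γ h‖ ^ 2 / 2) /
        (σ : ℝ) ^ 2))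
    have hm := measurable_nextMean A γ t
    have hfe : Measurable fun p : Hist n t × Vec n => f (γ.extend p.1 p.2) :=
      hf.comp (γ.measurable_extend t)
    have hw : Measurable fun p : Hist n t × Vec n => w p.1 p.2 := by
      have : Measurable fun p : Hist n t × Vec n => a • nextMean A γ p.1 :=
        (hm.comp measurable_fst).const_smul a
      simp only [w]
      fun_prop
    have hL := measurable_logLikelihood a A σ t
    calc ∫⁻ ω, f (scaledHistory a A γ (Y₁ ω) (fun s => V s ω) (t + 1)) ∂P
        = ∫⁻ ω, ∫⁻ v, f (γ.extend (scaledHistory a A γ (Y₁ ω) (fun s => V s ω) t)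
            (a • nextMean A γ (scaledHistory a A γ (Y₁ ω) (fun s => V s ω) t) + v)) ∂G ∂P := by
          have := lintegral_indepFun (hmeas a t) (hV (t + 1))
            (indepFun_scaledHistory hY hV hVi hYV a A γ t)
            (g := fun p => f (γ.extend p.1 (a • nextMean A γ p.1 + p.2)))
            (hfe.comp (measurable_fst.prodMk
              (((hm.comp measurable_fst).const_smul a).add measurable_snd)))
          rw [hG] at this
          exact this
      _ = ∫⁻ ω, (fun h => ∫⁻ v, f (γ.extend h v) * w h v ∂G)
            (scaledHistory a A γ (Y₁ ω) (fun s => V s ω) t) ∂P := by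
          refine lintegral_congr fun ω => ?_
          exact lintegral_add_isotropicGaussian hσ _
            (g := fun y => f (γ.extend (scaledHistory a A γ (Y₁ ω) (fun s => V s ω) t) y))
            (hfe.comp (measurable_const.prodMk measurable_id))
      _ = ∫⁻ ω, ∫⁻ v, (fun p : Hist n t × Vec n => f (γ.extend p.1 p.2) * w p.1 p.2 *
            ENNReal.ofReal (Real.exp (logLikelihood a A σ p.1)))
              (scaledHistory 0 A γ (Y₁ ω) (fun s => V s ω) t, v) ∂G ∂P := by
          have hF : Measurable fun h => ∫⁻ v, f (γ.extend h v) * w h v ∂G :=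
            (hfe.mul hw).lintegral_prod_right'
          -- The induction hypothesis is applied to `f` averaged over the last output, the last
          -- likelihood factor included; the drift of the last step is already removed by
          -- Cameron–Martin.
          rw [ih hF]
          refine lintegral_congr fun ω => ?_
          refine (lintegral_mul_const _ ?_).symm
          exact (hfe.mul hw).comp (measurable_const.prodMk measurable_id)
      _ = _ := by
          have := lintegral_indepFun (hmeas 0 t) (hV (t + 1))
            (indepFun_scaledHistory hY hV hVi hYV 0 A γ t)
            ((hfe.mul hw).mul (hL.comp measurable_fst).exp.ennreal_ofReal)
          rw [hG] at this
          refine this.symm.trans ?_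
          refine lintegral_congr fun ω => ?_
          simp only [Pi.mul_apply, Function.comp_apply, scaledHistory, zero_smul, zero_add,
            logLikelihood_extend, w]
          rw [Real.exp_add, ENNReal.ofReal_mul (Real.exp_nonneg _), mul_assoc,
            mul_comm (ENNReal.ofReal _)]

/-- Change of measure: an event on which the energy is at most `S` is not much less likely under
pure noise than in the closed loop. -/
theorem measure_history_sq_le {σ : ℝ≥0} (hσ : σ ≠ 0) (hY : Measurable Y₁)
    (hV : ∀ t, Measurable (V t))
    (hG : ∀ t, P.map (V t) =
      multivariateGaussian 0 ((σ : ℝ) ^ 2 • (1 : Matrix (Fin n) (Fin n) ℝ)))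
    (hVi : iIndepFun V P) (hYV : IndepFun Y₁ (fun ω t => V t ω) P)
    (A : Matrix (Fin n) (Fin n) ℝ) (γ : Controller n) (t : ℕ) {E : Set (Hist n t)}
    (hE : MeasurableSet E) {S : ℝ} (hS : ∀ h ∈ E, energy A h ≤ S) :
    P {ω | history A γ (Y₁ ω) (fun s => V s ω) t ∈ E} ^ 2 ≤
      P {ω | scaledHistory 0 A γ (Y₁ ω) (fun s => V s ω) t ∈ E} *
        ENNReal.ofReal (Real.exp (S / (σ : ℝ) ^ 2)) := by
  have hs : (0 : ℝ) < σ := by exact_mod_cast pos_iff_ne_zero.2 hσ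
  have hmeas : ∀ (b : ℝ),
      Measurable fun ω => scaledHistory b A γ (Y₁ ω) (fun s => V s ω) t := fun b =>
    (measurable_scaledHistory b A γ t).comp (hY.prodMk (measurable_pi_lambda _ hV))
  let Z : Ω → Hist n t := fun ω => scaledHistory 0 A γ (Y₁ ω) (fun s => V s ω) t
  have hZ : Measurable Z := hmeas 0
  let I : Hist n t → ℝ≥0∞ := E.indicator 1
  have hI : Measurable I := measurable_one.indicator hE
  let w : Hist n t → ℝ≥0∞ := fun h => ENNReal.ofReal (Real.exp (logLikelihood 1 A σ h))
  have hw : Measurable w := (measurable_logLikelihood 1 A σ t).exp.ennreal_ofReal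
  -- The indicator is written twice so that after Cauchy–Schwarz the squared likelihood is still
  -- restricted to `E`, where the energy is bounded.
  have h1 : P {ω | history A γ (Y₁ ω) (fun s => V s ω) t ∈ E} = ∫⁻ ω, I (Z ω) * (I * w) (Z ω) ∂P := by
    have e := lintegral_scaledHistory hσ hY hV hG hVi hYV 1 A γ t hI
    have : P {ω | history A γ (Y₁ ω) (fun s => V s ω) t ∈ E} =
        ∫⁻ ω, I (scaledHistory 1 A γ (Y₁ ω) (fun s => V s ω) t) ∂P := by
      rw [← lintegral_indicator_one]
      · simp only [scaledHistory_one, I]; rfl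
      · have := hmeas 1 hE
        simp only [scaledHistory_one] at this
        exact this
    rw [this, e]
    refine lintegral_congr fun ω => ?_
    change I (Z ω) * w (Z ω) = _
    by_cases hz : Z ω ∈ E <;> simp [I, hz]
  have h2 : ∫⁻ ω, I (Z ω) ^ (2 : ℝ) ∂P = P {ω | Z ω ∈ E} := by
    rw [show {ω | Z ω ∈ E} = Z ⁻¹' E from rfl, ← lintegral_indicator_one (hZ hE)]
    refine lintegral_congr fun ω => ?_
    by_cases hz : Z ω ∈ E <;> simp [I, hz]
  have h3 : ∫⁻ ω, (I * w) (Z ω) ^ (2 : ℝ) ∂P ≤ ENNReal.ofReal (Real.exp (S / (σ : ℝ) ^ 2)) := by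
    -- The squared likelihood is the likelihood for doubled drift times `exp(energy/σ²)`, and the
    -- doubled-drift likelihood has total mass one.
    have e := lintegral_scaledHistory hσ hY hV hG hVi hYV 2 A γ t (f := fun _ => 1)
      measurable_const
    simp only [lintegral_const, measure_univ, one_mul] at e
    calc ∫⁻ ω, (I * w) (Z ω) ^ (2 : ℝ) ∂P
        ≤ ∫⁻ ω, ENNReal.ofReal (Real.exp (logLikelihood 2 A σ (Z ω))) *
            ENNReal.ofReal (Real.exp (S / (σ : ℝ) ^ 2)) ∂P := by
          refine lintegral_mono fun ω => ?_
          by_cases hz : Z ω ∈ E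
          · simp only [Pi.mul_apply, I, hz, Set.indicator_of_mem, Pi.one_apply, one_mul, w]
            rw [ENNReal.rpow_two, ← ENNReal.ofReal_pow (Real.exp_nonneg _),
              ← ENNReal.ofReal_mul (Real.exp_nonneg _), ← Real.exp_add, ← Real.exp_nat_mul]
            refine ENNReal.ofReal_le_ofReal (Real.exp_le_exp.2 ?_)
            have : ((2 : ℕ) : ℝ) * logLikelihood 1 A σ (Z ω) =
                logLikelihood 2 A σ (Z ω) + energy A (Z ω) / (σ : ℝ) ^ 2 := by
              simp only [logLikelihood, energy, Finset.mul_sum, Finset.sum_div,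
                ← Finset.sum_add_distrib]
              refine Finset.sum_congr rfl fun s _ => ?_
              rw [norm_smul, inner_smul_left, norm_smul, inner_smul_left]
              simp
              ring
            rw [this]
            have := hS _ hz
            gcongr
          · simp [I, hz]
      _ = ENNReal.ofReal (Real.exp (S / (σ : ℝ) ^ 2)) := by
          have hL : Measurable fun ω => ENNReal.ofReal (Real.exp (logLikelihood 2 A σ (Z ω))) :=
            ((measurable_logLikelihood 2 A σ t).comp hZ).exp.ennreal_ofReal
          rw [lintegral_mul_const _ hL, ← e, one_mul]
  have hCS := ENNReal.lintegral_mul_le_Lp_mul_Lq P Real.HolderConjugate.two_two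
    (hI.comp hZ).aemeasurable ((hI.mul hw).comp hZ).aemeasurable
  calc P {ω | history A γ (Y₁ ω) (fun s => V s ω) t ∈ E} ^ 2
      ≤ ((P {ω | Z ω ∈ E}) ^ (1 / 2 : ℝ) *
          (ENNReal.ofReal (Real.exp (S / (σ : ℝ) ^ 2))) ^ (1 / 2 : ℝ)) ^ 2 := by
        gcongr
        rw [h1]
        refine hCS.trans ?_
        simp only [Function.comp_apply]
        rw [h2]
        gcongr
    _ = _ := by
        rw [mul_pow, ← ENNReal.rpow_two, ← ENNReal.rpow_two, ← ENNReal.rpow_mul,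
          ← ENNReal.rpow_mul]
        norm_num
        rfl

end Girsanov

/-! ### Good histories: decoding the parameter and probability bound -/

section Decoding

variable {n : ℕ} {Ω : Type*} [MeasurableSpace Ω] {P : Measure Ω}
  {Y₁ : Ω → Vec n} {V : ℕ → Ω → Vec n}

theorem empiricalMoment_dotProduct (A : Matrix (Fin n) (Fin n) ℝ) (γ : Controller n) (y₁ : Vec n)
    (v : ℕ → Vec n) (T : ℕ) (d : Vec n) :
    d.ofLp ⬝ᵥ (empiricalMoment A γ y₁ v T).mulVec d.ofLp =
      (T : ℝ)⁻¹ * ∑ t ∈ Finset.range T, ⟪d, output A γ y₁ v t⟫ ^ 2 := by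
  rw [empiricalMoment, Matrix.smul_mulVec, dotProduct_smul, Matrix.sum_mulVec, dotProduct_sum,
    smul_eq_mul]
  congr 1
  refine Finset.sum_congr rfl fun t _ => ?_
  rw [Matrix.vecMulVec_mulVec, dotProduct_smul, PiLp.inner_apply]
  simp [dotProduct, sq, mul_comm]

/-- The histories of length `T` on which the noiseless outputs of `A` have mean square at most `4 ε`
and the outputs excite each of the directions in `D`. -/
def goodHistories (A : Matrix (Fin n) (Fin n) ℝ) (T : ℕ) (c ε : ℝ) (D : Finset (Vec n)) :
    Set (Hist n T) :=
  {h | energy A h ≤ 4 * ε * T ∧ ∀ d ∈ D, c * T * ‖d‖ ^ 2 ≤ ∑ s : Fin T, ⟪d, h.1 s.castSucc⟫ ^ 2}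

/-- Testing only finitely many directions makes this a finite intersection. -/
theorem measurableSet_goodHistories (A : Matrix (Fin n) (Fin n) ℝ) (T : ℕ) (c ε : ℝ)
    (D : Finset (Vec n)) : MeasurableSet (goodHistories A T c ε D) := by
  have : goodHistories A T c ε D = {h : Hist n T | energy A h ≤ 4 * ε * T} ∩
      ⋂ d ∈ D, {h : Hist n T | c * T * ‖d‖ ^ 2 ≤ ∑ s : Fin T, ⟪d, h.1 s.castSucc⟫ ^ 2} := by
    ext; simp [goodHistories]
  rw [this]
  refine (measurableSet_le (measurable_energy A T) measurable_const).inter ?_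
  refine D.measurableSet_biInter fun d _ => measurableSet_le measurable_const ?_
  fun_prop

/-- The row `i` of a matrix. -/
noncomputable def rowVec (M : Matrix (Fin n) (Fin n) ℝ) (i : Fin n) : Vec n :=
  WithLp.toLp 2 (M i)

theorem inner_rowVec (M : Matrix (Fin n) (Fin n) ℝ) (i : Fin n) (y : Vec n) :
    ⟪rowVec M i, y⟫ = Matrix.toEuclideanCLM (n := Fin n) (𝕜 := ℝ) M y i := by
  simp [rowVec, PiLp.inner_apply, Matrix.mulVec, dotProduct, mul_comm]

/-- The parameter can be decoded from a good history. -/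
theorem disjoint_goodHistories {A B : Matrix (Fin n) (Fin n) ℝ} {T : ℕ} {c ε θ : ℝ}
    {D : Finset (Vec n)} (hT : 0 < T) (hc : 0 < c) (hθ : 16 * ε < c * θ ^ 2)
    {i j : Fin n} (hij : θ ≤ |A i j - B i j|) (hθ0 : 0 ≤ θ) (hD : rowVec (A - B) i ∈ D) :
    Disjoint (goodHistories A T c ε D) (goodHistories B T c ε D) := by
  rw [Set.disjoint_left]
  rintro h ⟨hA, hDA⟩ ⟨hB, -⟩
  have h1 := hDA _ hD
  have hT' : (0 : ℝ) < T := by exact_mod_cast hT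
  have h2 : θ ^ 2 ≤ ‖rowVec (A - B) i‖ ^ 2 := by
    have : |A i j - B i j| ≤ ‖rowVec (A - B) i‖ := by
      simpa [rowVec] using PiLp.norm_apply_le (rowVec (A - B) i) j
    exact pow_le_pow_left₀ hθ0 (hij.trans this) 2
  have h3 : ∀ s : Fin T, ⟪rowVec (A - B) i, h.1 s.castSucc⟫ ^ 2 ≤
      2 * ‖meanAt A h s‖ ^ 2 + 2 * ‖meanAt B h s‖ ^ 2 := by
    intro s
    have e : Matrix.toEuclideanCLM (n := Fin n) (𝕜 := ℝ) (A - B) (h.1 s.castSucc) =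
        meanAt A h s - meanAt B h s := by
      simp [meanAt]
    rw [inner_rowVec, e]
    have e1 := PiLp.norm_apply_le (meanAt A h s - meanAt B h s) i
    have e2 := norm_sub_le (meanAt A h s) (meanAt B h s)
    rw [← sq_abs, ← Real.norm_eq_abs]
    have e3 := pow_le_pow_left₀ (norm_nonneg _) (e1.trans e2) 2
    nlinarith [sq_nonneg (‖meanAt A h s‖ - ‖meanAt B h s‖)]
  have h4 := Finset.sum_le_sum fun s (_ : s ∈ Finset.univ) => h3 s
  rw [Finset.sum_add_distrib, ← Finset.mul_sum, ← Finset.mul_sum] at h4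
  change _ ≤ 2 * energy A h + 2 * energy B h at h4
  -- The two energies contribute `2 · 4εT` each, hence the `16 ε` in `hθ`.
  have h5 : c * T * θ ^ 2 ≤ c * T * ‖rowVec (A - B) i‖ ^ 2 := by gcongr
  nlinarith

theorem output_succ_sub (A : Matrix (Fin n) (Fin n) ℝ) (γ : Controller n) (y₁ : Vec n)
    (v : ℕ → Vec n) (t : ℕ) : output A γ y₁ v (t + 1) - v (t + 1) =
      Matrix.toEuclideanCLM (n := Fin n) (𝕜 := ℝ) A (output A γ y₁ v t) + input A γ y₁ v t := by
  rw [output_succ, add_sub_cancel_right]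

theorem regret_eq_lintegral_energy (A : Matrix (Fin n) (Fin n) ℝ) (γ : Controller n) (T : ℕ) :
    regret P Y₁ V γ A T =
      ∫⁻ ω, ENNReal.ofReal (energy A (history A γ (Y₁ ω) (fun s => V s ω) T)) ∂P := by
  refine lintegral_congr fun ω => ?_
  rw [history_eq, energy, ENNReal.ofReal_sum_of_nonneg fun _ _ => by positivity,
    Finset.sum_range]
  refine Finset.sum_congr rfl fun s _ => ?_
  rw [output_succ_sub A γ (Y₁ ω) (fun s => V s ω), ENNReal.ofReal_pow (norm_nonneg _),
    ofReal_norm]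
  simp [meanAt]

theorem regret_mono (A : Matrix (Fin n) (Fin n) ℝ) (γ : Controller n) {S T : ℕ} (h : S ≤ T) :
    regret P Y₁ V γ A S ≤ regret P Y₁ V γ A T :=
  lintegral_mono fun _ => Finset.sum_le_sum_of_subset (Finset.range_subset_range.2 h)

/-- Low regret and persistent excitation make good histories likely. -/
theorem quarter_le_measure_goodHistories (hY : Measurable Y₁) (hV : ∀ t, Measurable (V t))
    (A : Matrix (Fin n) (Fin n) ℝ) (γ : Controller n) {T : ℕ} (hT : 0 < T) {c δ ε : ℝ}
    (hδ : δ < 1 / 4) (hε : 0 < ε) (D : Finset (Vec n))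
    (hPE : ENNReal.ofReal (1 - δ) ≤
      P {ω | (empiricalMoment A γ (Y₁ ω) (fun s => V s ω) T
        - c • (1 : Matrix (Fin n) (Fin n) ℝ)).PosSemidef})
    (hR : regret P Y₁ V γ A T ≤ ENNReal.ofReal (2 * ε * T)) :
    1 / 4 ≤ P {ω | history A γ (Y₁ ω) (fun s => V s ω) T ∈ goodHistories A T c ε D} := by
  have hT' : (0 : ℝ) < T := by exact_mod_cast hT
  set H : Ω → Hist n T := fun ω => history A γ (Y₁ ω) (fun s => V s ω) T with hH
  have hHm : Measurable H := by
    have := (measurable_scaledHistory 1 A γ T).comp (hY.prodMk (measurable_pi_lambda _ hV))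
    simpa only [Function.comp_def, scaledHistory_one] using! this
  set F : Set Ω := {ω | (empiricalMoment A γ (Y₁ ω) (fun s => V s ω) T
        - c • (1 : Matrix (Fin n) (Fin n) ℝ)).PosSemidef} with hF
  set B : Set Ω := {ω | ENNReal.ofReal (4 * ε * T) ≤ ENNReal.ofReal (energy A (H ω))} with hB
  -- Markov's inequality at twice the mean bound; what remains of the excitation event has
  -- probability at least `3/4 - 1/2`.
  have hPB : P B ≤ 1 / 2 := by
    have m := mul_meas_ge_le_lintegral (μ := P)
      ((measurable_energy A T).comp hHm).ennreal_ofReal (ENNReal.ofReal (4 * ε * T))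
    rw [regret_eq_lintegral_energy] at hR
    have m' := m.trans hR
    have e : ENNReal.ofReal (4 * ε * T) = ENNReal.ofReal (2 * ε * T) * 2 := by
      rw [← ENNReal.ofReal_ofNat 2, ← ENNReal.ofReal_mul (by positivity)]
      congr 1; ring
    rw [e, mul_assoc] at m'
    have hp : ENNReal.ofReal (2 * ε * T) ≠ 0 := by
      simp only [ne_eq, ENNReal.ofReal_eq_zero, not_le]; positivity
    have m'' : 2 * P B ≤ 1 := by
      refine (ENNReal.mul_le_mul_iff_right hp ENNReal.ofReal_ne_top).1 ?_
      simp only [mul_one, hB, e]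
      exact m'
    rw [ENNReal.le_div_iff_mul_le (by simp) (by simp), mul_comm]
    exact m''
  have hsub : F ⊆ {ω | H ω ∈ goodHistories A T c ε D} ∪ B := by
    intro ω hω
    by_cases hb : ω ∈ B
    · exact Or.inr hb
    · refine Or.inl ⟨?_, fun d _ => ?_⟩
      · simp only [hB, Set.mem_ofPred_eq, not_le] at hb
        exact ((ENNReal.ofReal_lt_ofReal_iff_of_nonneg
          (Finset.sum_nonneg fun _ _ => by positivity)).1 hb).le
      · have hp := (Matrix.PosSemidef.dotProduct_mulVec_nonneg hω) d.ofLp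
        rw [Matrix.sub_mulVec, dotProduct_sub, star_trivial, empiricalMoment_dotProduct,
          Matrix.smul_mulVec, Matrix.one_mulVec, dotProduct_smul] at hp
        have e : d.ofLp ⬝ᵥ d.ofLp = ‖d‖ ^ 2 := by
          rw [EuclideanSpace.real_norm_sq_eq]; simp [dotProduct, sq]
        rw [e, smul_eq_mul, Finset.sum_range] at hp
        simp only [hH, history_eq, Fin.val_castSucc]
        set X := ∑ i : Fin T, ⟪d, output A γ (Y₁ ω) (fun s => V s ω) i⟫ ^ 2
        have : c * ‖d‖ ^ 2 ≤ (T : ℝ)⁻¹ * X := by linarith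
        calc c * T * ‖d‖ ^ 2 = T * (c * ‖d‖ ^ 2) := by ring
          _ ≤ T * ((T : ℝ)⁻¹ * X) := by gcongr
          _ = X := by rw [mul_inv_cancel_left₀ hT'.ne']
  have h34 : (3 / 4 : ℝ≥0∞) ≤ P F := by
    refine le_trans ?_ hPE
    rw [show (3 / 4 : ℝ≥0∞) = ENNReal.ofReal (3 / 4) by
      rw [ENNReal.ofReal_div_of_pos (by norm_num)]; simp]
    exact ENNReal.ofReal_le_ofReal (by linarith)
  have h5 : (3 / 4 : ℝ≥0∞) ≤ P {ω | H ω ∈ goodHistories A T c ε D} + 1 / 2 :=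
    h34.trans ((measure_mono hsub).trans ((measure_union_le _ _).trans (by gcongr)))
  have h6 : (3 / 4 : ℝ≥0∞) = 1 / 4 + 1 / 2 := by
    rw [← ENNReal.toReal_eq_toReal_iff' (by finiteness) (by finiteness),
      ENNReal.toReal_add (by finiteness) (by finiteness)]
    norm_num
  rw [h6] at h5
  exact (ENNReal.add_le_add_iff_right (by finiteness)).1 h5

end Decoding

/-! ### Grids of matrices in the uncertainty set -/

section Packing

variable {n : ℕ}

theorem norm_toEuclideanCLM_le_of_entries (M : Matrix (Fin n) (Fin n) ℝ) {b : ℝ} (hb : 0 ≤ b)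
    (h : ∀ i j, |M i j| ≤ b) : ‖Matrix.toEuclideanCLM (n := Fin n) (𝕜 := ℝ) M‖ ≤ n * b := by
  refine ContinuousLinearMap.opNorm_le_bound _ (by positivity) fun x => ?_
  refine le_of_sq_le_sq ?_ (by positivity)
  rw [EuclideanSpace.real_norm_sq_eq]
  have hi : ∀ i, (Matrix.toEuclideanCLM (n := Fin n) (𝕜 := ℝ) M x) i ^ 2 ≤
      n * b ^ 2 * ‖x‖ ^ 2 := by
    intro i
    rw [← inner_rowVec]
    have h1 := abs_real_inner_le_norm (rowVec M i) x
    have h2 : ‖rowVec M i‖ ^ 2 ≤ n * b ^ 2 := by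
      rw [EuclideanSpace.real_norm_sq_eq]
      refine (Finset.sum_le_card_nsmul _ _ (b ^ 2) fun j _ => ?_).trans (by simp)
      exact sq_le_sq.2 (by simpa [rowVec, abs_of_nonneg hb] using h i j)
    calc _ = |⟪rowVec M i, x⟫| ^ 2 := (sq_abs _).symm
      _ ≤ (‖rowVec M i‖ * ‖x‖) ^ 2 := by gcongr
      _ = ‖rowVec M i‖ ^ 2 * ‖x‖ ^ 2 := by ring
      _ ≤ _ := by gcongr
  refine (Finset.sum_le_card_nsmul _ _ _ fun i _ => hi i).trans (le_of_eq ?_)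
  simp
  ring

/-- The point with index `K` of the grid of mesh `θ` based at `C`. -/
noncomputable def gridPoint (C : Matrix (Fin n) (Fin n) ℝ) (θ : ℝ) {N : ℕ}
    (K : Fin n → Fin n → Fin N) : Matrix (Fin n) (Fin n) ℝ :=
  C + θ • Matrix.of fun i j => ((K i j : ℕ) : ℝ)

theorem norm_gridPoint_sub_le (C : Matrix (Fin n) (Fin n) ℝ) {θ : ℝ} (hθ : 0 ≤ θ) {N : ℕ}
    (hN : n * (θ * N) ≤ 1 / 8) (K : Fin n → Fin n → Fin N) :
    ‖Matrix.toEuclideanCLM (n := Fin n) (𝕜 := ℝ) (gridPoint C θ K - C)‖ ≤ 1 / 8 := by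
  refine (norm_toEuclideanCLM_le_of_entries _ (b := θ * N) (by positivity) fun i j => ?_).trans hN
  have : ((K i j : ℕ) : ℝ) ≤ N := by exact_mod_cast (K i j).2.le
  simp only [gridPoint, add_sub_cancel_left, Matrix.smul_apply, Matrix.of_apply, smul_eq_mul]
  rw [abs_of_nonneg (by positivity)]
  gcongr

theorem exists_le_abs_gridPoint_sub (C : Matrix (Fin n) (Fin n) ℝ) {θ : ℝ} (hθ : 0 ≤ θ) {N : ℕ}
    {K L : Fin n → Fin n → Fin N} (h : K ≠ L) :
    ∃ i j, θ ≤ |gridPoint C θ K i j - gridPoint C θ L i j| := by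
  obtain ⟨i, hi⟩ := Function.ne_iff.1 h
  obtain ⟨j, hj⟩ := Function.ne_iff.1 hi
  refine ⟨i, j, ?_⟩
  have e : gridPoint C θ K i j - gridPoint C θ L i j =
      θ * (((K i j : ℕ) : ℤ) - ((L i j : ℕ) : ℤ) : ℤ) := by
    simp [gridPoint]; ring
  rw [e, abs_mul, abs_of_nonneg hθ, ← Int.cast_abs]
  have : (1 : ℤ) ≤ |((K i j : ℕ) : ℤ) - ((L i j : ℕ) : ℤ)| := by
    refine Int.one_le_abs (sub_ne_zero.2 ?_)
    exact_mod_cast fun h => hj (Fin.ext h)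
  have : (1 : ℝ) ≤ ((|((K i j : ℕ) : ℤ) - ((L i j : ℕ) : ℤ)| : ℤ) : ℝ) := by exact_mod_cast this
  nlinarith

end Packing

/-! ### Lower bound on the first-step regret -/

section InitialState

variable {n : ℕ} {Ω : Type*} [MeasurableSpace Ω] {P : Measure Ω}
  {Y₁ : Ω → Vec n} {V : ℕ → Ω → Vec n}

/-- A controller cannot have small initial regret both near `0` and near `I / 2`. -/
theorem exists_center_regret_one_ge (hY : Measurable Y₁)
    (hY0 : ¬ (Y₁ =ᵐ[P] 0)) (γ : Controller n) :
    ∃ C : Matrix (Fin n) (Fin n) ℝ, ‖Matrix.toEuclideanCLM (n := Fin n) (𝕜 := ℝ) C‖ ≤ 1 / 2 ∧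
      ∃ η : ℝ≥0∞, 0 < η ∧ ∀ A : Matrix (Fin n) (Fin n) ℝ,
        ‖Matrix.toEuclideanCLM (n := Fin n) (𝕜 := ℝ) (A - C)‖ ≤ 1 / 8 →
          η ≤ regret P Y₁ V γ A 1 := by
  let J := ∫⁻ ω, ‖Y₁ ω‖ₑ ^ 2 ∂P
  have hJ : 0 < J := by
    rw [pos_iff_ne_zero]
    intro h0
    rw [lintegral_eq_zero_iff (by fun_prop)] at h0
    exact hY0 (h0.mono fun ω hω => by simpa using hω)
  obtain ⟨η, hη0, hη⟩ : ∃ η : ℝ≥0∞, 0 < η ∧ 64 * η < J := by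
    obtain ⟨η, h0, h1⟩ := exists_between (ENNReal.div_pos hJ.ne' (by simp : (64 : ℝ≥0∞) ≠ ∞))
    refine ⟨η, h0, ?_⟩
    rw [mul_comm]
    exact (ENNReal.lt_div_iff_mul_lt (by simp) (by simp)).1 h1
  have hreg : ∀ A : Matrix (Fin n) (Fin n) ℝ, regret P Y₁ V γ A 1 =
      ∫⁻ ω, ‖Matrix.toEuclideanCLM (n := Fin n) (𝕜 := ℝ) A (Y₁ ω) +
        γ.act 0 (fun _ => Y₁ ω, Fin.elim0)‖ₑ ^ 2 ∂P := by
    intro A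
    refine lintegral_congr fun ω => ?_
    rw [Finset.sum_range_one, output_succ_sub A γ (Y₁ ω) (fun s => V s ω)]
    rfl
  by_cases h : ∃ A : Matrix (Fin n) (Fin n) ℝ,
      ‖Matrix.toEuclideanCLM (n := Fin n) (𝕜 := ℝ) (A - 0)‖ ≤ 1 / 8 ∧ regret P Y₁ V γ A 1 < η
  · obtain ⟨A, hA, hAr⟩ := h
    have hhalf : ‖Matrix.toEuclideanCLM (n := Fin n) (𝕜 := ℝ)
        ((1 / 2 : ℝ) • (1 : Matrix (Fin n) (Fin n) ℝ))‖ ≤ 1 / 2 := by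
      refine ContinuousLinearMap.opNorm_le_bound _ (by norm_num) fun x => ?_
      simp [norm_smul]
    refine ⟨(1 / 2 : ℝ) • 1, hhalf, η, hη0, fun B hB => ?_⟩
    by_contra! hBr
    rw [sub_zero] at hA
    have hpt : ∀ ω, ‖Y₁ ω‖ₑ ^ 2 ≤
        32 * ‖Matrix.toEuclideanCLM (n := Fin n) (𝕜 := ℝ) A (Y₁ ω) +
          γ.act 0 (fun _ => Y₁ ω, Fin.elim0)‖ₑ ^ 2 +
        32 * ‖Matrix.toEuclideanCLM (n := Fin n) (𝕜 := ℝ) B (Y₁ ω) +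
          γ.act 0 (fun _ => Y₁ ω, Fin.elim0)‖ₑ ^ 2 := by
      intro ω
      set y := Y₁ ω
      set u := γ.act 0 (fun _ => y, Fin.elim0)
      set p := Matrix.toEuclideanCLM (n := Fin n) (𝕜 := ℝ) A y + u with hp
      set q := Matrix.toEuclideanCLM (n := Fin n) (𝕜 := ℝ) B y + u with hq
      have h1 := ((Matrix.toEuclideanCLM (n := Fin n) (𝕜 := ℝ) A).le_of_opNorm_le hA y)
      have h2 := ((Matrix.toEuclideanCLM (n := Fin n) (𝕜 := ℝ)
        (B - (1 / 2 : ℝ) • 1)).le_of_opNorm_le hB y)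
      -- The first input is the same for `A` and `B`, so it cancels in `q - p`.
      have h3 : (1 / 2 : ℝ) • y = Matrix.toEuclideanCLM (n := Fin n) (𝕜 := ℝ) A y -
          Matrix.toEuclideanCLM (n := Fin n) (𝕜 := ℝ) (B - (1 / 2 : ℝ) • 1) y + (q - p) := by
        simp [hp, hq]
      have h4 : 1 / 2 * ‖y‖ ≤ 1 / 8 * ‖y‖ + 1 / 8 * ‖y‖ + (‖q‖ + ‖p‖) := by
        calc 1 / 2 * ‖y‖ = ‖(1 / 2 : ℝ) • y‖ := by rw [norm_smul]; norm_num
          _ ≤ _ := by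
            rw [h3]
            exact (norm_add_le _ _).trans (add_le_add ((norm_sub_le _ _).trans
              (add_le_add h1 h2)) (norm_sub_le _ _))
      have h5 : ‖y‖ ^ 2 ≤ 32 * ‖p‖ ^ 2 + 32 * ‖q‖ ^ 2 := by
        have : ‖y‖ ≤ 4 * (‖q‖ + ‖p‖) := by linarith
        have := pow_le_pow_left₀ (norm_nonneg _) this 2
        nlinarith [sq_nonneg (‖q‖ - ‖p‖)]
      have h6 := ENNReal.ofReal_le_ofReal h5
      rw [ENNReal.ofReal_add (by positivity) (by positivity), ENNReal.ofReal_mul (by norm_num),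
        ENNReal.ofReal_mul (by norm_num), ENNReal.ofReal_pow (norm_nonneg _),
        ENNReal.ofReal_pow (norm_nonneg _), ENNReal.ofReal_pow (norm_nonneg _)] at h6
      simpa using h6
    have hγ := γ.measurable_act 0
    have hpm : Measurable fun ω => Matrix.toEuclideanCLM (n := Fin n) (𝕜 := ℝ) A (Y₁ ω) +
        γ.act 0 (fun _ => Y₁ ω, Fin.elim0) :=
      ((Matrix.toEuclideanCLM (n := Fin n) (𝕜 := ℝ) A).continuous.measurable.comp hY).add
        (hγ.comp ((measurable_pi_lambda _ fun _ => hY).prodMk measurable_const))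
    have := lintegral_mono hpt (μ := P)
    rw [lintegral_add_left (by fun_prop), lintegral_const_mul' _ _ (by simp),
      lintegral_const_mul' _ _ (by simp), ← hreg, ← hreg] at this
    refine (hη.trans_le this).not_ge ?_
    calc _ ≤ 32 * η + 32 * η := by gcongr
      _ = 64 * η := by ring
  · push Not at h
    exact ⟨0, by simp, η, hη0, h⟩

end InitialState

/-! ### Counting disjoint events, and asymptotics -/

section Counting

theorem sum_measure_le_of_disjoint_of_eq {Ω ι : Type*} [MeasurableSpace Ω] (P : Measure Ω)
    [IsProbabilityMeasure P] [Fintype ι] (S : ι → Set Ω) (hS : ∀ k, MeasurableSet (S k))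
    (ℓ : ι → ℕ) {L : ℕ} (hL : ∀ k, ℓ k < L)
    (hd : ∀ k l, k ≠ l → ℓ k = ℓ l → Disjoint (S k) (S l)) :
    ∑ k, P (S k) ≤ L := by
  classical
  rw [← Finset.sum_fiberwise_of_maps_to (s := Finset.univ) (t := Finset.range L) (g := ℓ)
    fun k _ => Finset.mem_range.2 (hL k)]
  refine (Finset.sum_le_card_nsmul _ _ 1 fun r _ => ?_).trans (by simp)
  rw [← measure_biUnion_finset _ fun k _ => hS k]
  · exact prob_le_one
  · intro k hk l hl hkl
    simp only [Finset.coe_filter, Finset.mem_univ, true_and, Set.mem_ofPred_eq] at hk hl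
    exact hd k l hkl (hk.trans hl.symm)

/-- Used with `x = 1/ε` and `τ = C x log x`: the right-hand side is about `b x^(1/4)`, the surplus
per matrix entry of the grid size over the likelihood cost. -/
theorem eventually_log_lt_rpow {b C : ℝ} (hb : 0 < b) (hC : 0 < C) :
    ∀ᶠ x : ℝ in atTop,
      1 ≤ (b * x ^ (1 / 2 : ℝ) - 1) * x ^ (-(1 / 4) : ℝ) ∧
      16 * (2 * Real.log (C * x * Real.log x) + 1) <
        (b * x ^ (1 / 2 : ℝ) - 1) * x ^ (-(1 / 4) : ℝ) := by
  have ho := (isLittleO_log_rpow_atTop (r := (1 / 4 : ℝ)) (by norm_num)).bound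
    (show 0 < b / 128 by positivity)
  have ht : ∀ᶠ x : ℝ in atTop, 4 / b * (32 * |Real.log C| + 20) ≤ x ^ (1 / 4 : ℝ) :=
    (tendsto_rpow_atTop (by norm_num : (0 : ℝ) < 1 / 4)).eventually_ge_atTop _
  filter_upwards [ho, ht, eventually_ge_atTop (Real.exp 1)] with x h1 h2 h3
  have hx : 0 < x := (Real.exp_pos 1).trans_le h3
  have hx1 : 1 ≤ x := (Real.one_le_exp (by norm_num)).trans h3
  have hl : 1 ≤ Real.log x := (Real.le_log_iff_exp_le hx).2 h3
  have hll : Real.log (Real.log x) ≤ Real.log x :=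
    (Real.log_le_sub_one_of_pos (by linarith)).trans (by linarith)
  rw [Real.norm_of_nonneg (by linarith), Real.norm_of_nonneg (by positivity)] at h1
  have e : (b * x ^ (1 / 2 : ℝ) - 1) * x ^ (-(1 / 4) : ℝ) =
      b * x ^ (1 / 4 : ℝ) - x ^ (-(1 / 4) : ℝ) := by
    rw [sub_mul, mul_assoc, ← Real.rpow_add hx]
    norm_num
  have hle : x ^ (-(1 / 4) : ℝ) ≤ 1 := Real.rpow_le_one_of_one_le_of_nonpos hx1 (by norm_num)
  have hlog : Real.log (C * x * Real.log x) = Real.log C + Real.log x + Real.log (Real.log x) := by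
    rw [Real.log_mul (by positivity) (by linarith), Real.log_mul hC.ne' hx.ne']
  have hb' : 4 * (32 * |Real.log C| + 20) ≤ b * x ^ (1 / 4 : ℝ) := by
    calc _ = b * (4 / b * (32 * |Real.log C| + 20)) := by field_simp
      _ ≤ _ := by gcongr
  rw [e, hlog]
  have := le_abs_self (Real.log C)
  have := abs_nonneg (Real.log C)
  constructor <;> linarith

end Counting

/-! ### Cardinality bound for quickly learned grids -/

/-- A cardinality bound for controllers that learn every point of a grid quickly. -/
theorem card_le_of_fast_learning {n : ℕ} {σ : ℝ≥0} (hσ : σ ≠ 0) {Ω : Type*} [MeasurableSpace Ω]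
    {P : Measure Ω} [IsProbabilityMeasure P] {Y₁ : Ω → Vec n} {V : ℕ → Ω → Vec n}
    (hY : Measurable Y₁) (hV : ∀ t, Measurable (V t))
    (hG : ∀ t, P.map (V t) =
      multivariateGaussian 0 ((σ : ℝ) ^ 2 • (1 : Matrix (Fin n) (Fin n) ℝ)))
    (hVi : iIndepFun V P) (hYV : IndepFun Y₁ (fun ω t => V t ω) P) (γ : Controller n)
    {c δ ε θ τ : ℝ} (hc : 0 < c) (hδ : δ < 1 / 4) (hε : 0 < ε) (hθ0 : 0 ≤ θ)
    (hθ : 16 * ε < c * θ ^ 2) {ι : Type*} [Fintype ι] [Nonempty ι]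
    (A : ι → Matrix (Fin n) (Fin n) ℝ)
    (hA : ∀ k l, k ≠ l → ∃ i j, θ ≤ |A k i j - A l i j|)
    (T : ι → ℕ) (hT : ∀ k, T k ≠ 0) (hTτ : ∀ k, (T k : ℝ) ≤ τ)
    (hR : ∀ k, regret P Y₁ V γ (A k) (T k) ≤ ENNReal.ofReal (ε * T k))
    (hPE : ∀ k, ENNReal.ofReal (1 - δ) ≤
      P {ω | (empiricalMoment (A k) γ (Y₁ ω) (fun s => V s ω) (2 ^ Nat.log 2 (T k))
        - c • (1 : Matrix (Fin n) (Fin n) ℝ)).PosSemidef}) :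
    (Fintype.card ι : ℝ) ≤
      16 * (2 * Real.log τ + 1) * Real.exp (4 * ε * τ / (σ : ℝ) ^ 2) := by
  classical
  obtain ⟨k₀⟩ := ‹Nonempty ι›
  let D : Finset (Vec n) :=
    Finset.univ.image fun p : (ι × ι) × Fin n => rowVec (A p.1.1 - A p.1.2) p.2
  let ℓ : ι → ℕ := fun k => Nat.log 2 (T k)
  have hℓT : ∀ k, 2 ^ ℓ k ≤ T k := fun k => Nat.pow_log_le_self 2 (hT k)
  let S : ι → Set Ω := fun k => {ω | scaledHistory 0 (A k) γ (Y₁ ω) (fun s => V s ω) (2 ^ ℓ k) ∈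
    goodHistories (A k) (2 ^ ℓ k) c ε D}
  let q : ℝ≥0∞ := ENNReal.ofReal (Real.exp (4 * ε * τ / (σ : ℝ) ^ 2))
  have hSm : ∀ k, MeasurableSet (S k) := fun k =>
    ((measurable_scaledHistory 0 (A k) γ (2 ^ ℓ k)).comp
      (hY.prodMk (measurable_pi_lambda _ hV))) (measurableSet_goodHistories _ _ _ _ _)
  have hSq : ∀ k, 1 / 16 ≤ P (S k) * q := by
    intro k
    have hTk : T k < 2 * 2 ^ ℓ k := by
      have := Nat.lt_pow_succ_log_self one_lt_two (T k)
      rwa [pow_succ, mul_comm] at this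
    -- Regret is monotone in time, so rounding the time down to a power of two costs at most a
    -- factor `2`.
    have hR' : regret P Y₁ V γ (A k) (2 ^ ℓ k) ≤
        ENNReal.ofReal (2 * ε * ((2 ^ ℓ k : ℕ) : ℝ)) := by
      refine (regret_mono (A k) γ (hℓT k)).trans ((hR k).trans (ENNReal.ofReal_le_ofReal ?_))
      have : (T k : ℝ) ≤ 2 * ((2 ^ ℓ k : ℕ) : ℝ) := by exact_mod_cast hTk.le
      nlinarith
    have h1 := quarter_le_measure_goodHistories hY hV (A k) γ (by positivity) hδ hε D (hPE k) hR'
    have h2 := measure_history_sq_le hσ hY hV hG hVi hYV (A k) γ (2 ^ ℓ k)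
      (measurableSet_goodHistories (A k) (2 ^ ℓ k) c ε D) (S := 4 * ε * τ) fun h hh => by
        refine hh.1.trans ?_
        have : ((2 ^ ℓ k : ℕ) : ℝ) ≤ τ := le_trans (by exact_mod_cast hℓT k) (hTτ k)
        gcongr
    refine le_trans ?_ ((pow_le_pow_left' h1 2).trans h2)
    rw [one_div, one_div, ← ENNReal.inv_pow]
    norm_num
  have hL : ∀ k, ℓ k < ⌊2 * Real.log τ⌋₊ + 1 := by
    intro k
    refine Nat.lt_succ_of_le (Nat.le_floor ?_)
    have h1 : ((2 : ℝ) ^ ℓ k) ≤ τ := le_trans (by exact_mod_cast hℓT k) (hTτ k)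
    have h2 := Real.log_le_log (by positivity) h1
    rw [Real.log_pow] at h2
    have := Real.log_two_gt_d9
    have : (0 : ℝ) ≤ ℓ k := Nat.cast_nonneg _
    nlinarith
  have hlog : 0 ≤ 2 * Real.log τ := by
    have : (1 : ℝ) ≤ τ := le_trans (by exact_mod_cast Nat.one_le_iff_ne_zero.2 (hT k₀)) (hTτ k₀)
    have := Real.log_nonneg this
    positivity
  have hsum := sum_measure_le_of_disjoint_of_eq P S hSm ℓ hL fun k l hkl hℓ => by
    obtain ⟨i, j, hij⟩ := hA k l hkl
    have hD : rowVec (A k - A l) i ∈ D :=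
      Finset.mem_image.2 ⟨((k, l), i), Finset.mem_univ _, rfl⟩
    have hdis := disjoint_goodHistories (T := 2 ^ ℓ k) (by positivity) hc hθ hij hθ0 hD
    -- Under pure noise both events are preimages under one and the same history map, so
    -- disjointness transfers.
    have hSl : S l = {ω | scaledHistory 0 (A k) γ (Y₁ ω) (fun s => V s ω) (2 ^ ℓ k) ∈
        goodHistories (A l) (2 ^ ℓ k) c ε D} := by
      simp only [S, scaledHistory_zero_eq (A l) γ (A k)]
      rw [hℓ]
    rw [hSl]
    exact hdis.preimage fun ω => scaledHistory 0 (A k) γ (Y₁ ω) (fun s => V s ω) (2 ^ ℓ k)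
  have hcard : (Fintype.card ι : ℝ≥0∞) * (1 / 16) ≤ ((⌊2 * Real.log τ⌋₊ + 1 : ℕ) : ℝ≥0∞) * q := by
    calc (Fintype.card ι : ℝ≥0∞) * (1 / 16) = ∑ _k : ι, (1 / 16 : ℝ≥0∞) := by simp
      _ ≤ ∑ k, P (S k) * q := Finset.sum_le_sum fun k _ => hSq k
      _ = (∑ k, P (S k)) * q := by rw [Finset.sum_mul]
      _ ≤ _ := by gcongr
  have hreal := ENNReal.toReal_mono (by finiteness) hcard
  simp only [ENNReal.toReal_mul, ENNReal.toReal_natCast, q,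
    ENNReal.toReal_ofReal (Real.exp_nonneg _)] at hreal
  have hfl := Nat.floor_le hlog
  have he := Real.exp_nonneg (4 * ε * τ / (σ : ℝ) ^ 2)
  norm_num at hreal
  nlinarith

theorem exists_fast_time {n : ℕ} {Ω : Type*} [MeasurableSpace Ω] {P : Measure Ω}
    {Y₁ : Ω → Vec n} {V : ℕ → Ω → Vec n} {γ : Controller n} {ε τ : ℝ}
    (h : (minTime P Y₁ V γ ε : ℝ≥0∞) < ENNReal.ofReal τ)
    {A : Matrix (Fin n) (Fin n) ℝ} (hA : A ∈ uncertaintySet n) :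
    ∃ T : ℕ, 1 ≤ T ∧ regret P Y₁ V γ A T < ENNReal.ofReal (ε * T) ∧ (T : ℝ) < τ := by
  by_contra! hcon
  refine h.not_ge ?_
  have hm : ((⌈τ⌉₊ : ℕ) : ℕ∞) ≤ minTime P Y₁ V γ ε := by
    refine le_trans ?_ (le_iSup₂ (f := fun A (_ : A ∈ uncertaintySet n) =>
      ⨅ T ∈ {T : ℕ | 1 ≤ T ∧ regret P Y₁ V γ A T / (T : ℝ≥0∞) < ENNReal.ofReal ε}, (T : ℕ∞)) A hA)
    refine le_iInf₂ fun T hT => ?_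
    have hT1 : (T : ℝ≥0∞) ≠ 0 := by simpa using (Nat.one_le_iff_ne_zero.1 hT.1)
    have hR : regret P Y₁ V γ A T < ENNReal.ofReal (ε * T) := by
      have := (ENNReal.div_lt_iff (.inl hT1) (.inl (by simp))).1 hT.2
      rwa [← ENNReal.ofReal_natCast, ← ENNReal.ofReal_mul' (Nat.cast_nonneg _)] at this
    exact_mod_cast Nat.ceil_le.2 (hcon T hT.1 hR)
  calc ENNReal.ofReal τ ≤ ((⌈τ⌉₊ : ℕ) : ℝ≥0∞) := by
        rw [← ENNReal.ofReal_natCast]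
        exact ENNReal.ofReal_le_ofReal (Nat.le_ceil τ)
    _ = (((⌈τ⌉₊ : ℕ) : ℕ∞) : ℝ≥0∞) := by simp
    _ ≤ _ := by exact_mod_cast hm

end AdaptiveControl

/-! ### The lower bound -/

theorem theorem4 (c δ : ℝ) (hc : 0 < c) (hδ : 0 < δ) (hδ' : δ < 1 / 4) :
    ∃ κ : ℝ, 0 < κ ∧
      ∀ (n : ℕ) (σ : ℝ≥0)
        (Ω : Type*) [MeasurableSpace Ω] (P : Measure Ω) [IsProbabilityMeasure P]
        (Y₁ : Ω → AdaptiveControl.Vec n) (V : ℕ → Ω → AdaptiveControl.Vec n),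
        Measurable Y₁ → (∀ t, Measurable (V t)) →
        -- the disturbances are i.i.d. Gaussian and independent of the initial state
        (∀ t, P.map (V t) =
          multivariateGaussian 0 ((σ : ℝ) ^ 2 • (1 : Matrix (Fin n) (Fin n) ℝ))) →
        iIndepFun V P →
        IndepFun Y₁ (fun ω t => V t ω) P →
        -- the initial state has a finite second moment and is not almost surely zero
        MemLp Y₁ 2 P →
        ¬ (Y₁ =ᵐ[P] 0) →
        ∀ γ : AdaptiveControl.Controller n,
          AdaptiveControl.PersistentExcitation P Y₁ V γ c δ →
          ∀ᶠ ε in 𝓝[>] (0 : ℝ),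
            ENNReal.ofReal (κ * ((n : ℝ) ^ 2 * (σ : ℝ) ^ 2 / ε * Real.log (1 / ε))) ≤
              (AdaptiveControl.minTime P Y₁ V γ ε : ℝ≥0∞) := by
  -- With `1/16` the likelihood cost `exp(4ετ/σ²)` is `ε^(-n²/4)`, against a grid of order
  -- `ε^(-n²/2)`.
  refine ⟨1 / 16, by norm_num, fun n σ Ω _ P _ Y₁ V hY hV hG hVi hYV _ hY0 γ hPE => ?_⟩
  rcases Nat.eq_zero_or_pos n with rfl | hn
  · simp
  rcases eq_or_ne σ 0 with rfl | hσ
  · simp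
  have hs : (0 : ℝ) < σ := by exact_mod_cast pos_iff_ne_zero.2 hσ
  have hn' : (1 : ℝ) ≤ n := by exact_mod_cast hn
  obtain ⟨C, hC, η, hη, hCη⟩ :=
    AdaptiveControl.exists_center_regret_one_ge (P := P) (V := V) hY hY0 γ
  obtain ⟨T₀, hT₀⟩ := hPE
  have hasym := AdaptiveControl.eventually_log_lt_rpow (b := √c / (40 * n))
    (C := 1 / 16 * ((n : ℝ) ^ 2 * (σ : ℝ) ^ 2)) (by positivity) (by positivity)
  have hsmall : ∀ᶠ ε : ℝ in 𝓝[>] 0, ENNReal.ofReal (ε * (2 * T₀)) < η := by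
    have : Tendsto (fun ε : ℝ => ENNReal.ofReal (ε * (2 * T₀))) (𝓝[>] 0) (𝓝 0) := by
      have h : Tendsto (fun ε : ℝ => ε * (2 * (T₀ : ℝ))) (𝓝[>] 0) (𝓝 (0 * (2 * (T₀ : ℝ)))) :=
        (tendsto_nhdsWithin_of_tendsto_nhds tendsto_id).mul_const _
      simpa using ENNReal.tendsto_ofReal h
    exact this.eventually_lt_const hη
  filter_upwards [tendsto_inv_nhdsGT_zero.eventually hasym, hsmall, self_mem_nhdsWithin]
    with ε hx hεη hε
  have hε : 0 < ε := hε
  by_contra! hcon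
  set τ := 1 / 16 * ((n : ℝ) ^ 2 * (σ : ℝ) ^ 2 / ε * Real.log (1 / ε)) with hτ
  -- Any factor above `4` gives the separation `16 ε < c θ²`.
  set θ := 5 * √(ε / c) with hθ
  have hθ0 : 0 < θ := by positivity
  set N := ⌊1 / (8 * n * θ)⌋₊ with hN
  have hNle : n * (θ * N) ≤ 1 / 8 := by
    have : (N : ℝ) ≤ 1 / (8 * n * θ) := Nat.floor_le (by positivity)
    calc n * (θ * N) ≤ n * (θ * (1 / (8 * n * θ))) := by gcongr
      _ = 1 / 8 := by field_simp
  let A : (Fin n → Fin n → Fin N) → Matrix (Fin n) (Fin n) ℝ := AdaptiveControl.gridPoint C θ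
  have hAC := AdaptiveControl.norm_gridPoint_sub_le C hθ0.le hNle
  have hAmem : ∀ K, A K ∈ AdaptiveControl.uncertaintySet n := by
    intro K
    have h1 := hAC K
    have h2 : Matrix.toEuclideanCLM (n := Fin n) (𝕜 := ℝ) (A K) =
        Matrix.toEuclideanCLM (n := Fin n) (𝕜 := ℝ) (A K - C) +
          Matrix.toEuclideanCLM (n := Fin n) (𝕜 := ℝ) C := by
      rw [← map_add, sub_add_cancel]
    change ‖Matrix.toEuclideanCLM (n := Fin n) (𝕜 := ℝ) (A K)‖ ≤ 1
    rw [h2]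
    exact (norm_add_le _ _).trans (by linarith [add_le_add h1 hC])
  choose T hT1 hTR hTτ using fun K => AdaptiveControl.exists_fast_time hcon (hAmem K)
  -- The factor `2` keeps the time at least `T₀` after rounding down to a power of two.
  have hTT : ∀ K, 2 * T₀ ≤ T K := by
    intro K
    by_contra! hlt
    have h1 := (hCη (A K) (hAC K)).trans_lt
      ((AdaptiveControl.regret_mono (A K) γ (hT1 K)).trans_lt (hTR K))
    refine (h1.trans_le (ENNReal.ofReal_le_ofReal ?_)).not_ge hεη.le
    have : (T K : ℝ) ≤ 2 * T₀ := by exact_mod_cast hlt.le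
    gcongr
  have hτC : τ = 1 / 16 * ((n : ℝ) ^ 2 * (σ : ℝ) ^ 2) * ε⁻¹ * Real.log ε⁻¹ := by
    rw [hτ, one_div ε]; ring
  rw [← hτC] at hx
  obtain ⟨hx1, hx2⟩ := hx
  have hexp : Real.exp (4 * ε * τ / (σ : ℝ) ^ 2) = (ε⁻¹ ^ (1 / 4 : ℝ)) ^ (n * n) := by
    rw [Real.rpow_def_of_pos (by positivity), ← Real.exp_nat_mul, hτC]
    congr 1
    push_cast
    field_simp
    norm_num
  have hNge : √c / (40 * n) * ε⁻¹ ^ (1 / 2 : ℝ) - 1 ≤ N := by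
    have h1 := (Nat.lt_floor_add_one (1 / (8 * n * θ))).le
    have h2 : 1 / (8 * n * θ) = √c / (40 * n) * ε⁻¹ ^ (1 / 2 : ℝ) := by
      rw [← Real.sqrt_eq_rpow, hθ, Real.sqrt_div hε.le, Real.sqrt_inv]
      field_simp
      norm_num
    linarith
  have hpos : 0 < ε⁻¹ ^ (1 / 4 : ℝ) := by positivity
  -- Dividing the count by the cost leaves `r^(n²) ≥ r`, which already exceeds the logarithmic
  -- factor.
  set r := (√c / (40 * n) * ε⁻¹ ^ (1 / 2 : ℝ) - 1) * ε⁻¹ ^ (-(1 / 4) : ℝ) with hr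
  have hrN : r * ε⁻¹ ^ (1 / 4 : ℝ) ≤ N := by
    rw [hr, mul_assoc, ← Real.rpow_add (by positivity)]
    simpa using hNge
  have hN0 : 0 < N := by
    have : 0 < r * ε⁻¹ ^ (1 / 4 : ℝ) := by positivity
    exact_mod_cast this.trans_le hrN
  have : Nonempty (Fin N) := ⟨⟨0, hN0⟩⟩
  have hcard := AdaptiveControl.card_le_of_fast_learning hσ hY hV hG hVi hYV γ hc hδ' hε hθ0.le
    (by
      rw [hθ, mul_pow, Real.sq_sqrt (by positivity)]
      field_simp
      norm_num) A
    (fun K L hKL => AdaptiveControl.exists_le_abs_gridPoint_sub C hθ0.le hKL) T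
    (fun K => Nat.one_le_iff_ne_zero.1 (hT1 K)) (fun K => (hTτ K).le) (fun K => (hTR K).le)
    fun K => hT₀ _ (hAmem K) _ (by
      have h1 := Nat.lt_pow_succ_log_self one_lt_two (T K)
      have h2 := hTT K
      rw [pow_succ] at h1
      omega)
  have hpow : r ^ (n * n) * (ε⁻¹ ^ (1 / 4 : ℝ)) ^ (n * n) ≤ (N : ℝ) ^ (n * n) := by
    rw [← mul_pow]
    exact pow_le_pow_left₀ (by positivity) hrN _
  have hcard' : (Fintype.card (Fin n → Fin n → Fin N) : ℝ) = (N : ℝ) ^ (n * n) := by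
    simp [pow_mul]
  rw [hcard', hexp] at hcard
  have hr1 : r ≤ r ^ (n * n) := le_self_pow₀ hx1 (by positivity)
  have := le_of_mul_le_mul_right (hpow.trans hcard) (by positivity)
  linarith
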